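/- Let $\Bbbk$ be an arbitrary field. An algebra means a vector space over $\Bbbk$ with a bilinear multiplication (not necessarily associative or unital), $(a,b,c)=(ab)c-a(bc)$ denotes the associator, and a variety of algebras is the class of all algebras satisfying some set of polynomial identities over $\Bbbk$. An algebra is left-symmetric if $(a,b,c)=(b,a,c)$ for all $a,b,c$. A left-symmetric algebra $A$ is special if there are an associative (not necessarily unital) algebra $P$ satisfying $abc=bac$, a derivation $d$ of $P$, and an injective linear map $\iota\colon A\to P$ such that $\iota(ab)=\iota(a)\,d(\iota(b))$ for all $a,b\in A$. An SLS-algebra is a left-symmetric algebra satisfying the identities \[((ax)y)b=((ay)x)b,\qquad (x,ya,b)=(y,xa,b).\] Then the class of all SLS-algebras is the smallest variety containing all special left-symmetric algebras; that is, it is a variety, every special left-symmetric algebra belongs to it, and every variety that contains all special left-symmetric algebras contains all SLS-algebras. -/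

import Mathlib

universe u v

/-- A (not necessarily associative, unital or commutative) algebra over `k`: a vector space with a
bilinear multiplication. The two last fields say that the multiplication is `k`-bilinear. -/
structure NAAlg (k : Type u) [Field k] where
  carrier : Type v
  [ring : NonUnitalNonAssocRing carrier]
  [module : Module k carrier]
  [scalarTower : IsScalarTower k carrier carrier]
  [smulComm : SMulCommClass k carrier carrier]

attribute [instance] NAAlg.ring NAAlg.module NAAlg.scalarTower NAAlg.smulComm

/-- The left symmetry `(a, b, c) = (b, a, c)`, where `(a, b, c) = (a b) c - a (b c)`. -/
def IsLeftSymmetric (A : Type v) [NonUnitalNonAssocRing A] : Prop :=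
  ∀ a b c : A, associator a b c = associator b a c

/-- SLS-algebras: left-symmetric algebras with `((a x) y) b = ((a y) x) b` and
`(x, y a, b) = (y, x a, b)`. -/
structure IsSLS (A : Type v) [NonUnitalNonAssocRing A] : Prop where
  leftSymm : IsLeftSymmetric A
  rightComm : ∀ a x y b : A, ((a * x) * y) * b = ((a * y) * x) * b
  assocSymm : ∀ x y a b : A, associator x (y * a) b = associator y (x * a) b

/-- A differential Perm-algebra over `k`: an associative (not necessarily unital) `k`-algebra with
`a b c = b a c` and a `k`-linear derivation `d`. -/
structure DiffPermAlg (k : Type u) [Field k] where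
  carrier : Type v
  [ring : NonUnitalRing carrier]
  [module : Module k carrier]
  [scalarTower : IsScalarTower k carrier carrier]
  [smulComm : SMulCommClass k carrier carrier]
  leftComm : ∀ a b c : carrier, a * b * c = b * a * c
  d : carrier →ₗ[k] carrier
  leibniz : ∀ a b : carrier, d (a * b) = d a * b + a * d b

attribute [instance] DiffPermAlg.ring DiffPermAlg.module DiffPermAlg.scalarTower
  DiffPermAlg.smulComm

/-- A left-symmetric algebra `A` is special if it embeds into a differential Perm-algebra in such a
way that the product of `A` becomes `a d(b)`. -/
def IsSpecial (k : Type u) [Field k] (A : Type v) [NonUnitalNonAssocRing A] [Module k A] : Prop :=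
  IsLeftSymmetric A ∧
    ∃ (P : DiffPermAlg.{u, v} k) (ι : A →ₗ[k] P.carrier),
      Function.Injective ι ∧ ∀ a b : A, ι (a * b) = ι a * P.d (ι b)

/-- `A` satisfies the identity `f = 0`, where `f` is a nonassociative polynomial over `k` without
constant term in the variables `x₀, x₁, x₂, …`: all substitutions of elements of `A` give `0`. -/
def NAAlg.Satisfies {k : Type u} [Field k] (A : NAAlg.{u, v} k)
    (f : FreeNonUnitalNonAssocAlgebra k ℕ) : Prop :=
  ∀ a : ℕ → A.carrier, FreeNonUnitalNonAssocAlgebra.lift k a f = 0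

/-- A variety of `k`-algebras: the class of all algebras that satisfy some set of identities. -/
def IsVariety {k : Type u} [Field k] (V : Set (NAAlg.{u, v} k)) : Prop :=
  ∃ S : Set (FreeNonUnitalNonAssocAlgebra k ℕ), V = {A | ∀ f ∈ S, A.Satisfies f}

/-! Special algebras are SLS by direct computation in the Perm-algebra, and SLS-algebras form a
variety by definition. The content is that every identity of special algebras holds in every
SLS-algebra `A`.

Left symmetry provides symmetric braces, and iterated braces evaluate a labelled rooted tree in `A`.
In the free differential Perm-algebra with product `a d(b)`, where the brace is `x₁ ⋯ xₙ dⁿ(a)`, a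
tree evaluates to a single monomial: the product of the `c⁽ᵐ⁾` over all vertices with label `c` and
`m` children, with the root kept apart. So the monomial forgets the shape of the tree and remembers
only the root and the multiset of the other vertices.

The key point is that values in an SLS-algebra forget just as much (`Forest.apply_eq`). The two SLS
identities say that right multiplications commute modulo the left annihilator and can be moved
between the arguments of a two-argument brace. Both properties spread to all operators `y ↦ {y, y₁,
…, yₙ; b}` (`IsSLS.isBalanced_braceHom`). Hence grafting operations preserve symmetry
(`IsCentral.graft`) and commute (`IsCentral.graft_comm`), and any tree can be normalized.

Thus monomial ↦ value is a well-defined linear map `treeValue`. The pairs (monomial, value) span a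
subalgebra of the product algebra, because multiplication of trees matches the Leibniz rule
(`Forest.exists_derivative`). A polynomial vanishing in the free object therefore vanishes in `A`
(`IsSLS.lift_eq_zero`). All sums run over positions and no division occurs, so the characteristic
plays no role. -/

/-! ### Sums over the entries of a list -/

/-- The sum of the values of `f` at the lists obtained from a list by applying `φ` to one entry. -/
def positionSum {A B : Type*} [AddCommGroup B] (φ : A → A) : (List A → B) → List A → B
  | _, [] => 0
  | f, y :: ys => f (φ y :: ys) + positionSum φ (fun l => f (y :: l)) ys

section PositionSum

variable {A B C : Type*} [AddCommGroup B] [AddCommGroup C]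

@[simp] lemma positionSum_nil (φ : A → A) (f : List A → B) : positionSum φ f [] = 0 := rfl

lemma positionSum_cons (φ : A → A) (f : List A → B) (y : A) (ys : List A) :
    positionSum φ f (y :: ys) = f (φ y :: ys) + positionSum φ (fun l => f (y :: l)) ys := rfl

lemma positionSum_rel {r : B → C → Prop} (h0 : r 0 0)
    (hadd : ∀ b b' c c', r b c → r b' c' → r (b + b') (c + c')) {φ ψ : A → A} :
    ∀ {f : List A → B} {g : List A → C} {l : List A},
      (∀ l₁ u l₂, (l₁ ++ u :: l₂).length = l.length → r (f (l₁ ++ φ u :: l₂)) (g (l₁ ++ ψ u :: l₂))) →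
      r (positionSum φ f l) (positionSum ψ g l)
  | _, _, [], _ => h0
  | _, _, y :: ys, h =>
    hadd _ _ _ _ (h [] y ys rfl) (positionSum_rel h0 hadd fun l₁ u l₂ hl =>
      h (y :: l₁) u l₂ (by simp at hl ⊢; omega))

lemma positionSum_congr {φ : A → A} {f g : List A → B} {l : List A}
    (h : ∀ l' : List A, l'.length = l.length → f l' = g l') :
    positionSum φ f l = positionSum φ g l :=
  positionSum_rel (r := Eq) rfl (by rintro _ _ _ _ rfl rfl; rfl) fun l₁ u l₂ hl => h _ (by simpa using hl)

lemma map_positionSum {φ : A → A} (F : B →+ C) (f : List A → B) (l : List A) :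
    F (positionSum φ f l) = positionSum φ (fun l => F (f l)) l :=
  positionSum_rel (r := fun b c => F b = c) (map_zero F)
    (by rintro _ _ _ _ rfl rfl; exact map_add F _ _) fun _ _ _ _ => rfl

lemma positionSum_add (φ : A → A) (f g : List A → B) (l : List A) :
    positionSum φ (fun l => f l + g l) l = positionSum φ f l + positionSum φ g l := by
  induction l generalizing f g with
  | nil => simp
  | cons y ys ih => simp only [positionSum_cons, ih]; abel

lemma positionSum_sub (φ : A → A) (f g : List A → B) (l : List A) :
    positionSum φ (fun l => f l - g l) l = positionSum φ f l - positionSum φ g l := by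
  induction l generalizing f g with
  | nil => simp
  | cons y ys ih => simp only [positionSum_cons, ih]; abel

lemma positionSum_append (φ : A → A) (f : List A → B) (l l' : List A) :
    positionSum φ f (l ++ l') =
      positionSum φ (fun m => f (m ++ l')) l + positionSum φ (fun m => f (l ++ m)) l' := by
  induction l generalizing f with
  | nil => simp
  | cons y ys ih => simp only [List.cons_append, positionSum_cons, ih, add_assoc]

lemma positionSum_perm {φ : A → A} {l l' : List A} (h : l.Perm l') {f : List A → B}
    (hf : ∀ l l' : List A, l.Perm l' → f l = f l') : positionSum φ f l = positionSum φ f l' := by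
  induction h generalizing f with
  | nil => rfl
  | cons x h ih =>
    rw [positionSum_cons, positionSum_cons, hf _ _ (h.cons _), ih fun _ _ h => hf _ _ (h.cons _)]
  | swap x y l =>
    simp only [positionSum_cons]
    rw [hf _ _ (.swap x (φ y) l), hf _ _ (.swap (φ x) y l),
      show (fun l => f (y :: x :: l)) = fun l => f (x :: y :: l) from
        funext fun l => hf _ _ (.swap ..)]
    abel
  | trans _ _ ih ih' => rw [ih hf, ih' hf]

/-- Terms in which the two maps hit different entries agree on both sides. On a common entry the
outer map acts first, so the left double sum contributes `ψ ∘ φ`; the added sums make both sides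
contain both compositions. -/
lemma positionSum_positionSum (φ ψ : A → A) (f : List A → B) (l : List A) :
    positionSum φ (positionSum ψ f) l + positionSum (φ ∘ ψ) f l =
      positionSum ψ (positionSum φ f) l + positionSum (ψ ∘ φ) f l := by
  induction l generalizing f with
  | nil => simp
  | cons y ys ih =>
    have := ih fun l => f (y :: l)
    simp only [positionSum_cons, positionSum_add, Function.comp_apply]
    have key : ∀ a b c d e g p q r s : B, d + s = e + r →
        (a + b + (c + d)) + (q + s) = (q + c + (b + e)) + (a + r) := by
      intro a b c d e g p q r s h
      have : d = e + r - s := by rw [← h]; abel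
      subst this; abel
    exact key _ _ _ _ _ 0 0 _ _ _ this

end PositionSum

/-- Additivity in each entry of the list. -/
def MultiAdditive {A B : Type*} [Add A] [Add B] (f : List A → B) : Prop :=
  ∀ l₁ l₂ u v, f (l₁ ++ (u + v) :: l₂) = f (l₁ ++ u :: l₂) + f (l₁ ++ v :: l₂)

section MultiAdditive

variable {A B : Type*} [AddCommGroup A] [AddCommGroup B]

lemma MultiAdditive.cons {f : List A → B} (hf : MultiAdditive f) (y : A) :
    MultiAdditive fun l => f (y :: l) := fun l₁ l₂ u v => hf (y :: l₁) l₂ u v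

lemma MultiAdditive.positionSum_fun {f : List A → B} (hf : MultiAdditive f) (φ ψ : A → A)
    (l : List A) :
    positionSum (fun u => φ u + ψ u) f l = positionSum φ f l + positionSum ψ f l := by
  induction l generalizing f with
  | nil => simp
  | cons y ys ih =>
    have := hf [] ys (φ y) (ψ y)
    simp only [List.nil_append] at this
    simp only [positionSum_cons, ih (hf.cons y), this]
    abel

lemma MultiAdditive.positionSum {f : List A → B} (hf : MultiAdditive f) (φ : A →+ A) :
    MultiAdditive (positionSum φ f) := by
  intro l₁
  induction l₁ generalizing f with
  | nil =>
    intro l₂ u v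
    have h1 := hf [] l₂ (φ u) (φ v)
    have h2 : (fun l => f ((u + v) :: l)) = fun l => f (u :: l) + f (v :: l) :=
      funext fun l => hf [] l u v
    simp only [List.nil_append] at h1
    simp only [List.nil_append, positionSum_cons, map_add, h1, h2, positionSum_add]
    abel
  | cons y ys ih =>
    intro l₂ u v
    have h1 := hf (φ y :: ys) l₂ u v
    simp only [List.cons_append] at h1
    simp only [List.cons_append, positionSum_cons, h1, ih (hf.cons y)]
    abel

end MultiAdditive

/-! ### The symmetric brace operations of a left-symmetric algebra -/

section Brace

variable {A : Type*} [NonUnitalNonAssocRing A]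

/-- The restriction of `brace` to lists of a given length, extended by zero. -/
def braceAux (a : A) : ℕ → List A → A
  | 0, [] => a
  | 0, _ :: _ => 0
  | _ + 1, [] => 0
  | n + 1, x :: xs => x * braceAux a n xs - positionSum (x * ·) (braceAux a n) xs

/-- The symmetric brace `{x₁, …, xₙ; a}` of a left-symmetric algebra. In a differential
Perm-algebra with the product `a d(b)` it is `x₁ ⋯ xₙ dⁿ(a)`. -/
def brace (xs : List A) (a : A) : A := braceAux a xs.length xs

@[simp] lemma brace_nil (a : A) : brace [] a = a := rfl

lemma brace_cons (x : A) (xs : List A) (a : A) :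
    brace (x :: xs) a = x * brace xs a - positionSum (x * ·) (fun l => brace l a) xs := by
  have : positionSum (x * ·) (fun l => brace l a) xs =
      positionSum (x * ·) (braceAux a xs.length) xs :=
    positionSum_congr fun l hl => by rw [brace, hl]
  rw [this]; rfl

@[simp] lemma brace_singleton (x a : A) : brace [x] a = x * a := by simp [brace_cons]

lemma brace_pair (x y a : A) : brace [x, y] a = x * (y * a) - (x * y) * a := by
  rw [brace_cons, positionSum_cons]; simp

lemma mul_brace (x : A) (xs : List A) (a : A) :
    x * brace xs a = brace (x :: xs) a + positionSum (x * ·) (fun l => brace l a) xs := by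
  rw [brace_cons]; abel

lemma multiAdditive_braceAux (a : A) (n : ℕ) : MultiAdditive (braceAux a n) := by
  induction n with
  | zero => intro l₁ l₂ u v; cases l₁ <;> simp [braceAux]
  | succ n ih =>
    rintro (_ | ⟨x, l₁⟩) l₂ u v
    · simp only [List.nil_append, braceAux, ih.positionSum_fun, add_mul]
      abel
    · have := (ih.positionSum (AddMonoidHom.mulLeft x)) l₁ l₂ u v
      simp only [AddMonoidHom.coe_mulLeft] at this
      simp only [List.cons_append, braceAux, ih l₁ l₂ u v, mul_add, this]
      abel

lemma multiAdditive_brace (a : A) : MultiAdditive fun l => brace l a := fun l₁ l₂ u v => by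
  have := multiAdditive_braceAux a (l₁ ++ u :: l₂).length l₁ l₂ u v
  simpa [brace] using this

lemma positionSum_braceAux_zero (φ : A → A) (a : A) (l : List A) :
    positionSum φ (braceAux a 0) l = 0 :=
  positionSum_rel (r := fun b c : A => b = 0) (g := fun _ => (0 : A)) (ψ := φ) rfl
    (by rintro _ _ _ _ rfl rfl; simp) fun l₁ u l₂ _ => by cases l₁ <;> rfl

/-- After unfolding the recursion twice, the part not symmetric in `x` and `y` cancels by left
symmetry, used once on the inner brace (`hs`) and once on each entry of `xs` (`hd`). -/
lemma braceAux_swap (hA : IsLeftSymmetric A) (a : A) (n : ℕ) (x y : A) (xs : List A) :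
    braceAux a (n + 1) (x :: y :: xs) = braceAux a (n + 1) (y :: x :: xs) := by
  cases n with
  | zero => simp [braceAux, positionSum_braceAux_zero]
  | succ n =>
    have expand : ∀ x y : A, braceAux a (n + 2) (x :: y :: xs) =
        x * (y * braceAux a n xs) - (x * y) * braceAux a n xs
          - x * positionSum (y * ·) (braceAux a n) xs - y * positionSum (x * ·) (braceAux a n) xs
          + positionSum ((x * y) * ·) (braceAux a n) xs
          + positionSum (x * ·) (positionSum (y * ·) (braceAux a n)) xs := by
      intro x y
      have h1 : (fun l => braceAux a (n + 1) (y :: l)) =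
          fun l => y * braceAux a n l - positionSum (y * ·) (braceAux a n) l := rfl
      have h2 : positionSum (x * ·) (fun l => y * braceAux a n l) xs =
          y * positionSum (x * ·) (braceAux a n) xs :=
        (map_positionSum (AddMonoidHom.mulLeft y) _ _).symm
      have h3 : ∀ (z : A), braceAux a (n + 1) (z :: xs) = 
        z * braceAux a n xs - positionSum (z * ·) (braceAux a n) xs := fun _ => rfl
      rw [show braceAux a (n + 2) (x :: y :: xs) = x * braceAux a (n + 1) (y :: xs) -
        positionSum (x * ·) (braceAux a (n + 1)) (y :: xs) from rfl, positionSum_cons, h1,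
        positionSum_sub, h2, h3, h3, mul_sub]
      abel
    have hc := positionSum_positionSum (x * ·) (y * ·) (braceAux a n) xs
    have hs := hA x y (braceAux a n xs)
    have hd : positionSum ((x * y) * ·) (braceAux a n) xs +
          positionSum ((y * ·) ∘ (x * ·)) (braceAux a n) xs =
        positionSum ((y * x) * ·) (braceAux a n) xs +
          positionSum ((x * ·) ∘ (y * ·)) (braceAux a n) xs := by
      rw [← (multiAdditive_braceAux a n).positionSum_fun,
        ← (multiAdditive_braceAux a n).positionSum_fun]
      congr 1
      funext w
      have := hA x y w
      simp only [associator] at this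
      simp only [Function.comp_apply]
      rw [sub_eq_sub_iff_add_eq_add] at this
      rw [this]
    rw [expand x y, expand y x]
    simp only [associator] at hs
    generalize braceAux a n xs = t at *
    rw [sub_eq_sub_iff_add_eq_add] at hs
    grind

lemma braceAux_perm (hA : IsLeftSymmetric A) (a : A) (n : ℕ) {l l' : List A} (h : l.Perm l') :
    braceAux a n l = braceAux a n l' := by
  induction n generalizing l l' with
  | zero =>
    cases l with
    | nil => rw [h.nil_eq]
    | cons x l => cases l' with
      | nil => exact absurd h.eq_nil (by simp)
      | cons => rfl
  | succ n ih =>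
    induction h with
    | nil => rfl
    | cons x h => simp only [braceAux, ih h, positionSum_perm h fun _ _ => ih]
    | swap x y l => exact braceAux_swap hA a n y x l
    | trans _ _ h h' => exact h.trans h'

lemma brace_perm (hA : IsLeftSymmetric A) (a : A) {l l' : List A} (h : l.Perm l') :
    brace l a = brace l' a := by
  rw [brace, brace, h.length_eq, braceAux_perm hA a _ h]

/-- The map `y ↦ {y, y₁, …, yₙ; b}`. -/
def braceHom (ys : List A) (b : A) : A →+ A :=
  AddMonoidHom.mk' (fun y => brace (y :: ys) b) fun u v => multiAdditive_brace b [] ys u v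

@[simp] lemma braceHom_apply (ys : List A) (b y : A) : braceHom ys b y = brace (y :: ys) b := rfl

lemma brace_cons_add (u v : A) (xs : List A) (a : A) :
    brace ((u + v) :: xs) a = brace (u :: xs) a + brace (v :: xs) a := (braceHom xs a).map_add u v

lemma brace_cons_sub (u v : A) (xs : List A) (a : A) :
    brace ((u - v) :: xs) a = brace (u :: xs) a - brace (v :: xs) a := (braceHom xs a).map_sub u v

end Brace

/-! ### Operators that commute modulo the left annihilator -/

section Balanced

variable {A : Type*} [NonUnitalNonAssocRing A]

/-- Congruence modulo the left annihilator. -/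
def LeftEq (w w' : A) : Prop := ∀ b, w * b = w' * b

lemma LeftEq.refl (w : A) : LeftEq w w := fun _ => rfl

lemma LeftEq.symm {w w' : A} (h : LeftEq w w') : LeftEq w' w := fun b => (h b).symm

lemma LeftEq.add {u u' w w' : A} (h : LeftEq u u') (h' : LeftEq w w') :
    LeftEq (u + w) (u' + w') := fun b => by rw [add_mul, add_mul, h b, h' b]

lemma LeftEq.sub {u u' w w' : A} (h : LeftEq u u') (h' : LeftEq w w') :
    LeftEq (u - w) (u' - w') := fun b => by rw [sub_mul, sub_mul, h b, h' b]

lemma LeftEq.brace_cons {w w' : A} (h : LeftEq w w') (xs : List A) (a : A) :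
    brace (w :: xs) a = brace (w' :: xs) a := by
  have : (w * ·) = (w' * ·) := funext h
  rw [_root_.brace_cons, _root_.brace_cons, h, this]

/-- The operator `O` can be moved from one argument of a brace to another. -/
def Movable (O : A →+ A) : Prop :=
  ∀ y x xs a, brace (O y :: x :: xs) a = brace (y :: O x :: xs) a

lemma perm_third {α : Type*} (z y x : α) (xs : List α) :
    (z :: y :: x :: xs).Perm (y :: x :: z :: xs) :=
  (List.Perm.swap y z _).trans ((List.Perm.swap x z _).cons y)

lemma perm_cons_middle {α : Type*} (y w : α) (l₁ l₂ : List α) :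
    (y :: (l₁ ++ w :: l₂)).Perm (w :: y :: (l₁ ++ l₂)) :=
  (List.perm_middle.cons y).trans (List.Perm.swap w y _)

/-- A brace of two arguments is minus an associator, so the base case is `assocSymm`. In the
induction an argument `z` is brought to the front and expanded; the terms with a product by `z` are
normalized to braces whose second argument is `z` itself. -/
lemma IsSLS.brace_mulRight_move (hA : IsSLS A) (b : A) (n : ℕ) (xs : List A) (hn : xs.length = n)
    (y x a : A) : brace (y * b :: x :: xs) a = brace (y :: x * b :: xs) a := by
  induction n generalizing xs y x b with
  | zero =>
    obtain rfl := List.length_eq_zero_iff.1 hn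
    rw [brace_perm hA.leftSymm a (.swap x (y * b) []), brace_pair, brace_pair]
    have := hA.assocSymm x y b a
    simp only [associator] at this
    rw [← neg_inj, neg_sub, neg_sub, this]
  | succ n ih =>
    obtain ⟨z, zs, rfl⟩ := List.exists_cons_of_length_eq_add_one hn
    have hz : zs.length = n := by simpa using hn
    have move : ∀ w u v, brace (u * w :: v :: zs) a = brace (u :: v * w :: zs) a :=
      fun w u v => ih w zs hz u v
    have comm : ∀ u v, brace (u :: v :: zs) a = brace (v :: u :: zs) a :=
      fun u v => brace_perm hA.leftSymm a (.swap v u zs)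
    have right : ∀ u w w' v, brace ((u * w) * w' :: v :: zs) a = brace ((u * w') * w :: v :: zs) a :=
      fun u w w' v => LeftEq.brace_cons (fun c => hA.rightComm u w w' c) _ a
    rw [← brace_perm hA.leftSymm a (perm_third z (y * b) x zs),
      ← brace_perm hA.leftSymm a (perm_third z y (x * b) zs), brace_cons z, brace_cons z,
      positionSum_cons, positionSum_cons, positionSum_cons, positionSum_cons, move b y x]
    have h4 : positionSum (z * ·) (fun l => brace (y * b :: x :: l) a) zs =
        positionSum (z * ·) (fun l => brace (y :: x * b :: l) a) zs :=
      positionSum_congr fun l hl => ih b l (hl.trans hz) y x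
    have e1 : brace (z * (y * b) :: x :: zs) a = brace (x * (y * b) :: z :: zs) a := by
      rw [move, comm]
    have e2 : brace (y :: z * (x * b) :: zs) a = brace (y * (x * b) :: z :: zs) a := by
      rw [← move]
    have e3 : ∀ x y, brace (z * y :: x * b :: zs) a = brace ((x * y) * b :: z :: zs) a := by
      intro x y
      rw [← move, right, move, comm, ← move]
    -- What remains after normalization is exactly left symmetry of `x`, `y`, `b` in the first
    -- argument.
    have e4 : brace (x * (y * b) :: z :: zs) a + brace ((y * x) * b :: z :: zs) a =
        brace ((x * y) * b :: z :: zs) a + brace (y * (x * b) :: z :: zs) a := by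
      have := hA.leftSymm x y b
      simp only [associator] at this
      rw [sub_eq_sub_iff_add_eq_add] at this
      rw [← brace_cons_add, ← brace_cons_add, this, add_comm]
    rw [e1, e2, e3, comm (y * b), e3, h4, ← add_assoc, e4, add_assoc]

/-- Expand `{z, O y, x, …; a} = {z, y, O x, …; a}` along `z`: the terms in which `z` multiplies
outside or hits another entry cancel, and the rest is the claim. -/
lemma Movable.commutator {O : A →+ A} (h : Movable O) (hA : IsLeftSymmetric A) (z : A) :
    Movable ((AddMonoidHom.mulLeft z).comp O - O.comp (AddMonoidHom.mulLeft z)) := by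
  intro y x xs a
  have comm : ∀ u v, brace (u :: v :: xs) a = brace (v :: u :: xs) a :=
    fun u v => brace_perm hA a (.swap v u xs)
  have key : brace (z :: O y :: x :: xs) a = brace (z :: y :: O x :: xs) a := by
    rw [brace_perm hA a (perm_third z (O y) x xs), h, brace_perm hA a (perm_third z y (O x) xs)]
  have hf : (fun l => brace (O y :: x :: l) a) = fun l => brace (y :: O x :: l) a :=
    funext fun l => h y x l a
  rw [brace_cons z, brace_cons z, h, sub_right_inj] at key
  simp only [positionSum_cons, hf] at key
  rw [← add_assoc, ← add_assoc, add_left_inj] at key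
  rw [comm y]
  simp only [AddMonoidHom.sub_apply, AddMonoidHom.comp_apply, AddMonoidHom.coe_mulLeft,
    brace_cons_sub]
  rw [h (z * y), comm (z * O x), comm (O (z * x)), ← h y, sub_eq_sub_iff_add_eq_add, key, add_comm]

lemma IsSLS.movable_mulRight (hA : IsSLS A) (b : A) : Movable (AddMonoidHom.mulRight b) :=
  fun y x xs a => hA.brace_mulRight_move b _ xs rfl y x a

/-- By the brace recursion, the operator for `z :: zs` is the commutator of left multiplication by
`z` with the operator for `zs`, minus operators for lists of the length of `zs`. Induction starts
from right multiplication. -/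
lemma IsSLS.movable_braceHom (hA : IsSLS A) (ys : List A) (b : A) : Movable (braceHom ys b) := by
  induction hn : ys.length generalizing ys with
  | zero =>
    obtain rfl := List.length_eq_zero_iff.1 hn
    intro y x xs a
    simpa using hA.movable_mulRight b y x xs a
  | succ n ih =>
    obtain ⟨z, zs, rfl⟩ := List.exists_cons_of_length_eq_add_one hn
    have hz : zs.length = n := by simpa using hn
    intro y x xs a
    have expand : ∀ y, braceHom (z :: zs) b y =
        ((AddMonoidHom.mulLeft z).comp (braceHom zs b) -
          (braceHom zs b).comp (AddMonoidHom.mulLeft z)) y -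
          positionSum (z * ·) (fun l => braceHom l b y) zs := by
      intro y
      simp only [braceHom_apply, AddMonoidHom.sub_apply, AddMonoidHom.comp_apply,
        AddMonoidHom.coe_mulLeft]
      rw [brace_perm hA.leftSymm b (.swap z y zs), brace_cons, positionSum_cons]
      abel
    have comm : ∀ u v, brace (u :: v :: xs) a = brace (v :: u :: xs) a :=
      fun u v => brace_perm hA.leftSymm a (.swap v u xs)
    have hsum : ∀ y x, brace (positionSum (z * ·) (fun l => braceHom l b y) zs :: x :: xs) a =
        positionSum (z * ·) (fun l => brace (braceHom l b y :: x :: xs) a) zs := fun y x =>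
      map_positionSum (braceHom (x :: xs) a) _ _
    rw [expand, comm y, expand, brace_cons_sub, brace_cons_sub, hsum, hsum,
      ((ih zs hz).commutator hA.leftSymm z) y x xs a, comm y]
    congr 1
    exact positionSum_congr fun l hl => by rw [ih l (hl.trans hz), comm]

/-- An operator that commutes with right multiplications modulo the left annihilator and can be
moved between the arguments of braces. -/
structure IsBalanced (O : A →+ A) : Prop where
  move : Movable O
  comm : ∀ z w, LeftEq (O z * w) (O (z * w))

lemma IsSLS.isBalanced_mulRight (hA : IsSLS A) (b : A) : IsBalanced (AddMonoidHom.mulRight b) :=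
  ⟨hA.movable_mulRight b, fun z w c => hA.rightComm z b w c⟩

/-- Expanding along the first argument reduces to shorter braces. In the terms where `O z`
multiplies a later entry, `O` is first pulled out of the product and then moved onto `y`. -/
lemma IsBalanced.leftEq_brace {O : A →+ A} (hO : IsBalanced O) (hA : IsLeftSymmetric A)
    (z : A) (ys : List A) (b : A) : LeftEq (brace (O z :: ys) b) (O (brace (z :: ys) b)) := by
  induction hn : ys.length generalizing ys z with
  | zero =>
    obtain rfl := List.length_eq_zero_iff.1 hn
    simpa using hO.comm z b
  | succ n ih =>
    obtain ⟨y, ys, rfl⟩ := List.exists_cons_of_length_eq_add_one hn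
    have hy : ys.length = n := by simpa using hn
    have hperm : ∀ w l₁ l₂, brace (y :: (l₁ ++ w :: l₂)) b = brace (w :: y :: (l₁ ++ l₂)) b :=
      fun w l₁ l₂ => brace_perm hA b (perm_cons_middle y w l₁ l₂)
    have hmove : positionSum (O z * ·) (fun l => brace (y :: l) b) ys =
        positionSum (z * ·) (fun l => brace (O y :: l) b) ys := by
      refine positionSum_rel (r := Eq) rfl (by rintro _ _ _ _ rfl rfl; rfl) fun l₁ u l₂ _ => ?_
      rw [hperm, (hO.comm z u).brace_cons, hO.move,
        brace_perm hA b (perm_cons_middle (O y) (z * u) l₁ l₂)]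
    have hsum : LeftEq (positionSum (z * ·) (fun l => brace (O y :: l) b) ys)
        (O (positionSum (z * ·) (fun l => brace (y :: l) b) ys)) := by
      rw [map_positionSum]
      refine positionSum_rel (LeftEq.refl 0) (fun _ _ _ _ => LeftEq.add) fun l₁ u l₂ hl => ?_
      exact ih y _ (by simpa [hy] using hl)
    rw [brace_cons (O z), brace_cons z, positionSum_cons, positionSum_cons, hmove, map_sub, map_add]
    refine (hO.comm _ _).sub (LeftEq.add ?_ hsum)
    intro c
    rw [(hO.comm z y).brace_cons]
    exact ih _ ys hy c

lemma IsSLS.isBalanced_braceHom (hA : IsSLS A) (ys : List A) (b : A) :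
    IsBalanced (braceHom ys b) :=
  ⟨hA.movable_braceHom ys b, fun z w =>
    ((hA.isBalanced_mulRight w).leftEq_brace hA.leftSymm z ys b).symm⟩

/-! ### Central functions and grafting -/

/-- Functions of lists that behave as multilinear symmetric functions over a commutative algebra
generated by the balanced operators. -/
structure IsCentral (f : List A → A) : Prop where
  perm : ∀ {l l'}, l.Perm l' → f l = f l'
  add : ∀ u v l, f ((u + v) :: l) = f (u :: l) + f (v :: l)
  congr : ∀ {w w'}, LeftEq w w' → ∀ l, f (w :: l) = f (w' :: l)
  move : ∀ {O : A →+ A}, IsBalanced O → ∀ y x l, f (O y :: x :: l) = f (y :: O x :: l)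

lemma isCentral_brace (hA : IsLeftSymmetric A) (a : A) : IsCentral fun l => brace l a where
  perm h := brace_perm hA a h
  add u v l := brace_cons_add u v l a
  congr h l := h.brace_cons l a
  move hO y x l := hO.move y x l a

/-- The function of lists obtained from `f` by first applying `{·, …, ·; c}` to the first `m`
entries. -/
def graft (c : A) (m : ℕ) (f : List A → A) (l : List A) : A := f (brace (l.take m) c :: l.drop m)

lemma perm_invariant_of_swap {α β : Type*} {f : List α → β}
    (h : ∀ l₁ x y l₂, f (l₁ ++ x :: y :: l₂) = f (l₁ ++ y :: x :: l₂)) {l l' : List α}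
    (hl : l.Perm l') : f l = f l' := by
  suffices ∀ l₁, f (l₁ ++ l) = f (l₁ ++ l') from this []
  induction hl with
  | nil => exact fun _ => rfl
  | cons x _ ih => exact fun l₁ => by simpa using ih (l₁ ++ [x])
  | swap x y l => exact fun l₁ => h l₁ y x l
  | trans _ _ ih ih' => exact fun l₁ => (ih l₁).trans (ih' l₁)

lemma IsCentral.graft (hA : IsSLS A) {f : List A → A} (hf : IsCentral f) (c : A) (m : ℕ) :
    IsCentral (graft c m f) where
  perm := by
    refine perm_invariant_of_swap fun l₁ x y l₂ => ?_
    rcases lt_trichotomy m (l₁.length + 1) with h | h | h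
    · have : m - l₁.length = 0 := by omega
      simp only [_root_.graft, List.take_append, List.drop_append, this, List.take_zero,
        List.drop_zero]
      exact hf.perm (((List.Perm.swap _ _ _).append_left _).cons _)
    -- The only swap that needs more than symmetry: `x` is the last grafted entry and `y` the first
    -- one left out. It amounts to moving the operator `braceHom l₁ c` from `x` to `y`.
    · have : m - l₁.length = 1 := by omega
      have ht : l₁.take m = l₁ := List.take_of_length_le (by omega)
      have hd : l₁.drop m = [] := List.drop_eq_nil_of_le (by omega)
      simp only [_root_.graft, List.take_append, List.drop_append, this, ht, hd,
        List.take_succ_cons, List.drop_succ_cons, List.take_zero, List.drop_zero, List.nil_append]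
      rw [brace_perm hA.leftSymm c (List.perm_append_singleton x l₁),
        brace_perm hA.leftSymm c (List.perm_append_singleton y l₁)]
      have := hf.move (hA.isBalanced_braceHom l₁ c) x y l₂
      simp only [braceHom_apply] at this
      rw [this, hf.perm (.swap _ x l₂)]
    · obtain ⟨k, hk⟩ : ∃ k, m - l₁.length = k + 2 := ⟨m - l₁.length - 2, by omega⟩
      simp only [_root_.graft, List.take_append, List.drop_append, hk, List.take_succ_cons,
        List.drop_succ_cons]
      rw [brace_perm hA.leftSymm c ((List.Perm.swap _ _ _).append_left _)]
  add u v l := by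
    rcases m with _ | m
    · simp only [_root_.graft, List.take_zero, List.drop_zero, brace_nil]
      rw [hf.perm (.swap (u + v) c l), hf.add, hf.perm (.swap u c l), hf.perm (.swap v c l)]
    · simp only [_root_.graft, List.take_succ_cons, List.drop_succ_cons, brace_cons_add, hf.add]
  congr {w w'} h l := by
    rcases m with _ | m
    · simp only [_root_.graft, List.take_zero, List.drop_zero, brace_nil]
      rw [hf.perm (.swap w c l), hf.congr h, hf.perm (.swap w' c l)]
    · simp only [_root_.graft, List.take_succ_cons, List.drop_succ_cons, h.brace_cons]
  move {O} hO y x l := by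
    rcases m with _ | _ | m
    · simp only [_root_.graft, List.take_zero, List.drop_zero, brace_nil]
      rw [hf.perm (perm_third c (O y) x l), hf.move hO, hf.perm (perm_third c y (O x) l)]
    · simp only [_root_.graft, List.take_succ_cons, List.drop_succ_cons, List.take_zero,
        List.drop_zero, brace_singleton, zero_add]
      rw [hf.congr (hO.comm y c), hf.move hO]
    · simp only [_root_.graft, List.take_succ_cons, List.drop_succ_cons, hO.move y x]

lemma graft_append (c : A) {m : ℕ} (f : List A → A) {l : List A} (hl : l.length = m)
    (l' : List A) : graft c m f (l ++ l') = f (brace l c :: l') := by simp [graft, ← hl]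

/-- By symmetry both sides may be nested around one entry `x`, giving `{{x, vs; b}, us; c}` and
`{{x, us; c}, vs; b}`, which agree modulo the left annihilator. The bound is the number of entries
both grafts consume; on shorter lists `take` would truncate. -/
lemma IsCentral.graft_comm (hA : IsSLS A) {f : List A → A} (hf : IsCentral f) (b c : A)
    (m n : ℕ) {l : List A} (hl : m + n + 1 ≤ l.length) :
    _root_.graft b (m + 1) (_root_.graft c (n + 1) f) l =
      _root_.graft c (n + 1) (_root_.graft b (m + 1) f) l := by
  obtain ⟨x, l, rfl⟩ : ∃ x l', l = x :: l' := List.exists_cons_of_length_pos (by omega)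
  obtain ⟨vs, l, rfl, hv⟩ : ∃ vs l', l = vs ++ l' ∧ vs.length = m :=
    ⟨l.take m, l.drop m, by simp, by simp at hl ⊢; omega⟩
  obtain ⟨us, l, rfl, hu⟩ : ∃ us l', l = us ++ l' ∧ us.length = n :=
    ⟨l.take n, l.drop n, by simp, by simp at hl ⊢; omega⟩
  have h1 : x :: (vs ++ (us ++ l)) = (x :: vs) ++ (us ++ l) := rfl
  have h2 : x :: (us ++ (vs ++ l)) = (x :: us) ++ (vs ++ l) := rfl
  rw [((hf.graft hA b (m + 1)).graft hA c (n + 1)).perm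
    (l' := x :: (us ++ (vs ++ l))) (by
      rw [← List.append_assoc, ← List.append_assoc]
      exact (List.perm_append_comm.append_right l).cons x), h1, h2]
  rw [graft_append b _ (by simp [hv]), graft_append c _ (by simp [hu]), ← List.cons_append,
    ← List.cons_append, graft_append c _ (by simp [hu]), graft_append b _ (by simp [hv])]
  exact hf.congr ((hA.isBalanced_braceHom vs b).leftEq_brace hA.leftSymm x us c) l

end Balanced

/-! ### Values of monomials -/

section Forest

variable {X A : Type*} [NonUnitalNonAssocRing A] {α : X → A}

/-- `Forest α M l`: there is a list of planar rooted trees with the values `l` whose vertices,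
with their labels and numbers of children, form the multiset `M`. -/
inductive Forest (α : X → A) : Multiset (X × ℕ) → List A → Prop
  | nil : Forest α 0 []
  | node {M : Multiset (X × ℕ)} {ys xs : List A} {m : ℕ} (c : X) (hm : ys.length = m)
      (h : Forest α M (ys ++ xs)) : Forest α ((c, m) ::ₘ M) (brace ys (α c) :: xs)

lemma Forest.append {M M' : Multiset (X × ℕ)} {l l' : List A} (h : Forest α M l)
    (h' : Forest α M' l') : Forest α (M + M') (l ++ l') := by
  induction h with
  | nil => simpa using h'
  | node c hm _ ih =>
    rw [Multiset.cons_add]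
    exact .node c hm (by simpa using ih)

lemma Forest.eq_zero {M : Multiset (X × ℕ)} (h : Forest α M []) : M = 0 := by
  cases h; rfl

lemma Forest.eq_nil {l : List A} (h : Forest α 0 l) : l = [] := by
  generalize hM : (0 : Multiset (X × ℕ)) = M at h
  cases h with
  | nil => rfl
  | node => exact absurd hM.symm (Multiset.cons_ne_zero)

/-- The composition of the grafting operators of a list of vertices, where `(c, m)` stands for a
vertex with the label `c` and `m + 1` children. -/
def graftAll (α : X → A) (σ : List (X × ℕ)) (f : List A → A) : List A → A :=
  σ.foldr (fun p g => graft (α p.1) (p.2 + 1) g) f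

@[simp] lemma graftAll_cons (p : X × ℕ) (σ : List (X × ℕ)) (f : List A → A) :
    graftAll α (p :: σ) f = graft (α p.1) (p.2 + 1) (graftAll α σ f) := rfl

lemma IsCentral.graftAll (hA : IsSLS A) {f : List A → A} (hf : IsCentral f)
    (σ : List (X × ℕ)) : IsCentral (graftAll α σ f) := by
  induction σ with
  | nil => exact hf
  | cons p σ ih => exact ih.graft hA _ _

lemma IsCentral.graftAll_perm (hA : IsSLS A) {f : List A → A} (hf : IsCentral f)
    {σ σ' : List (X × ℕ)} (h : σ.Perm σ') {l : List A}
    (hl : (σ.map Prod.snd).sum + 1 ≤ l.length) :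
    _root_.graftAll α σ f l = _root_.graftAll α σ' f l := by
  induction h generalizing l with
  | nil => rfl
  | cons p h ih =>
    simp only [graftAll_cons]
    refine ih ?_
    simp at hl ⊢
    omega
  | swap p q σ =>
    simp only [List.map_cons, List.sum_cons] at hl
    exact (hf.graftAll hA σ).graft_comm hA _ _ _ _ (by omega)
  | trans h _ ih ih' => rw [ih hl, ih' (by rwa [← (h.map _).sum_eq])]

/-- The multiset of vertices with the internal vertices `σ` (in the convention of `graftAll`) and
the leaves `μ`. -/
def vertices (σ : List (X × ℕ)) (μ : List X) : Multiset (X × ℕ) :=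
  ((σ.map fun p => (p.1, p.2 + 1) : List (X × ℕ)) : Multiset (X × ℕ)) +
    ((μ.map fun c => (c, 0) : List (X × ℕ)) : Multiset (X × ℕ))

lemma exists_eq_vertices (M : Multiset (X × ℕ)) : ∃ σ μ, M = vertices σ μ := by
  induction M using Multiset.induction with
  | empty => exact ⟨[], [], rfl⟩
  | cons p M ih =>
    obtain ⟨σ, μ, rfl⟩ := ih
    obtain ⟨c, _ | m⟩ := p
    · exact ⟨σ, c :: μ, by simp [vertices, ← Multiset.cons_coe]⟩
    · exact ⟨(c, m) :: σ, μ, by simp [vertices, ← Multiset.cons_coe]⟩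

lemma perm_of_cons_eq_vertices {c : X} {m : ℕ} {M : Multiset (X × ℕ)} {σ : List (X × ℕ)}
    {μ : List X} (h : (c, m + 1) ::ₘ M = vertices σ μ) :
    ∃ σ', σ.Perm ((c, m) :: σ') ∧ M = vertices σ' μ := by
  have : (c, m) ∈ σ := by
    have h1 : (c, m + 1) ∈ vertices σ μ := h ▸ Multiset.mem_cons_self _ _
    simpa [vertices] using h1
  obtain ⟨s, t, rfl⟩ := List.append_of_mem this
  refine ⟨s ++ t, List.perm_middle, ?_⟩
  have h2 : vertices (s ++ (c, m) :: t) μ = (c, m + 1) ::ₘ vertices (s ++ t) μ := by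
    simp only [vertices, List.map_append, List.map_cons, ← Multiset.coe_add, ← Multiset.cons_coe,
      Multiset.add_cons, Multiset.cons_add]
  rw [h2] at h
  exact (Multiset.cons_inj_right _).1 h

lemma perm_of_cons_zero_eq_vertices {c : X} {M : Multiset (X × ℕ)} {σ : List (X × ℕ)}
    {μ : List X} (h : (c, 0) ::ₘ M = vertices σ μ) :
    ∃ μ', μ.Perm (c :: μ') ∧ M = vertices σ μ' := by
  have : c ∈ μ := by
    have h1 : (c, 0) ∈ vertices σ μ := h ▸ Multiset.mem_cons_self _ _
    simpa [vertices] using h1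
  obtain ⟨s, t, rfl⟩ := List.append_of_mem this
  refine ⟨s ++ t, List.perm_middle, ?_⟩
  have h2 : vertices σ (s ++ c :: t) = (c, 0) ::ₘ vertices σ (s ++ t) := by
    simp only [vertices, List.map_append, List.map_cons, ← Multiset.coe_add, ← Multiset.cons_coe,
      Multiset.add_cons]
  rw [h2] at h
  exact (Multiset.cons_inj_right _).1 h

/-- The forest is dismantled from its roots: `τ` collects the internal vertices already removed and
`e` the leaves set aside. The length bound is carried along because reordering the grafts requires
it. -/
lemma Forest.graftAll_eq (hA : IsSLS A) {M : Multiset (X × ℕ)} {l : List A} (h : Forest α M l)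
    {f : List A → A} (hf : IsCentral f) {σ : List (X × ℕ)} {μ : List X} (hM : M = vertices σ μ)
    (τ : List (X × ℕ)) (e : List A) (hl : (τ.map Prod.snd).sum + 1 ≤ (l ++ e).length) :
    graftAll α τ f (l ++ e) = graftAll α (σ ++ τ) f (μ.map α ++ e) ∧
      ((σ ++ τ).map Prod.snd).sum + 1 ≤ (μ.map α ++ e).length := by
  induction h generalizing σ μ τ e with
  | nil =>
    have h1 := congrArg Multiset.card hM
    simp only [vertices, Multiset.card_zero, Multiset.card_add, Multiset.coe_card,
      List.length_map] at h1
    obtain rfl := List.length_eq_zero_iff.1 (show σ.length = 0 by omega)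
    obtain rfl := List.length_eq_zero_iff.1 (show μ.length = 0 by omega)
    exact ⟨rfl, hl⟩
  | @node M ys xs m c hm h ih =>
    rcases m with _ | m
    · obtain ⟨μ', hμ, hM'⟩ := perm_of_cons_zero_eq_vertices hM
      obtain rfl := List.length_eq_zero_iff.1 hm
      have hp : ∀ s : List A, (α c :: (s ++ e)).Perm (s ++ α c :: e) :=
        fun s => List.perm_middle.symm
      obtain ⟨h1, h2⟩ := ih hM' τ (α c :: e) (by simp at hl ⊢; omega)
      constructor
      · rw [brace_nil, List.cons_append, (hf.graftAll hA τ).perm (hp xs)]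
        rw [List.nil_append] at h1
        rw [h1, ← (hf.graftAll hA _).perm (hp _)]
        exact (hf.graftAll hA _).perm ((hμ.map α).symm.append_right e)
      · have := hμ.length_eq
        simp at h2 this ⊢
        omega
    · obtain ⟨σ', hσ, hM'⟩ := perm_of_cons_eq_vertices hM
      obtain ⟨h1, h2⟩ := ih hM' ((c, m) :: τ) e (by simp at hl ⊢; omega)
      have hp : (σ' ++ (c, m) :: τ).Perm (σ ++ τ) :=
        List.perm_middle.trans (hσ.symm.append_right τ)
      refine ⟨?_, by rwa [← (hp.map _).sum_eq]⟩
      rw [← hf.graftAll_perm hA hp h2, ← h1, graftAll_cons, List.append_assoc, graft_append _ _ hm,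
        List.cons_append]

/-- Both forests reduce to the same grafts applied to the same leaves, since these are read off from
`M` alone. -/
lemma Forest.apply_eq (hA : IsSLS A) {M : Multiset (X × ℕ)} {l l' : List A} (h : Forest α M l)
    (h' : Forest α M l') {f : List A → A} (hf : IsCentral f) : f l = f l' := by
  -- The empty list violates the length bound of `Forest.graftAll_eq` and is treated apart.
  rcases l.eq_nil_or_concat with rfl | hl
  · rw [h.eq_zero] at h'
    rw [h'.eq_nil]
  rcases l'.eq_nil_or_concat with rfl | hl'
  · rw [h'.eq_zero] at h
    rw [h.eq_nil]
  have pos : 0 < l.length := by obtain ⟨_, _, rfl⟩ := hl; simp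
  have pos' : 0 < l'.length := by obtain ⟨_, _, rfl⟩ := hl'; simp
  obtain ⟨σ, μ, hM⟩ := exists_eq_vertices M
  have e := (h.graftAll_eq hA hf hM [] [] (by simp; omega)).1
  have e' := (h'.graftAll_eq hA hf hM [] [] (by simp; omega)).1
  simpa [graftAll] using e.trans e'.symm

/-- Attaching the tree `u` as a new child of a vertex `(c, m)` turns it into `(c, m + 1)`, as `D`
does to a variable; summing over the vertices is the Leibniz rule. Quantifying over all central `f`
lets the induction replace `f` by a graft of it. -/
lemma Forest.exists_derivative {k : Type*} [CommRing k]
    {D : Derivation k (MvPolynomial (X × ℕ) k) (MvPolynomial (X × ℕ) k)}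
    (hD : ∀ p, D (MvPolynomial.X p) = MvPolynomial.X (p.1, p.2 + 1))
    (hA : IsSLS A) {R M : Multiset (X × ℕ)} {u : A} {l : List A}
    (hR : Forest α R [u]) (h : Forest α M l) :
    ∃ L : List (Multiset (X × ℕ) × List A),
      (∀ p ∈ L, Forest α p.1 p.2 ∧ p.2.length = l.length) ∧
      (L.map fun p => (p.1.map (MvPolynomial.X (R := k))).prod).sum =
        (R.map MvPolynomial.X).prod * D (M.map MvPolynomial.X).prod ∧
      ∀ f, IsCentral f → positionSum (u * ·) f l = (L.map fun p => f p.2).sum := by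
  induction h with
  | nil => exact ⟨[], by simp⟩
  | @node M ys xs m c hm h ih =>
    obtain ⟨L, hL, hX, hf⟩ := ih
    -- The head attaches `u` to the root `c` itself; the tail attaches it elsewhere and then
    -- restores the root over the first `m` trees.
    refine ⟨((c, m + 1) ::ₘ (R + M), brace (u :: ys) (α c) :: xs) ::
      L.map fun p => ((c, m) ::ₘ p.1, brace (p.2.take m) (α c) :: p.2.drop m), ?_, ?_, ?_⟩
    · rintro p hp
      rcases List.mem_cons.1 hp with rfl | hp
      · exact ⟨.node c (by simp [hm]) (by simpa using hR.append h), by simp⟩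
      · obtain ⟨q, hq, rfl⟩ := List.mem_map.1 hp
        obtain ⟨h1, h2⟩ := hL q hq
        rw [List.length_append, hm] at h2
        exact ⟨.node c (by simp; omega) (by simpa using h1), by simp; omega⟩
    · simp only [List.map_cons, List.map_map, List.sum_cons, Multiset.map_cons,
        Multiset.prod_cons, Function.comp_def, List.sum_map_mul_left, hX, Multiset.map_add,
        Multiset.prod_add, Derivation.leibniz, hD, smul_eq_mul]
      ring
    · intro f hc
      have h1 := hf _ (hc.graft hA (α c) m)
      have h2 : positionSum (u * ·) (fun l => graft (α c) m f (l ++ xs)) ys =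
          f (positionSum (u * ·) (fun l => brace l (α c)) ys :: xs) := by
        have h3 := map_positionSum (φ := (u * ·)) (AddMonoidHom.mk' (fun w => f (w :: xs))
          fun v w => hc.add v w xs) (fun l => brace l (α c)) ys
        rw [AddMonoidHom.mk'_apply] at h3
        rw [h3]
        exact positionSum_congr fun l hl => by rw [graft_append _ _ (hl.trans hm)]
      have h4 : (fun l => graft (α c) m f (ys ++ l)) = fun l => f (brace ys (α c) :: l) :=
        funext fun l => graft_append _ _ hm l
      rw [positionSum_append, h2, h4] at h1
      rw [positionSum_cons, mul_brace, hc.add, add_assoc, h1]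
      simp [graft, Function.comp_def]

end Forest

/-! ### Identities of special algebras -/

section Special

variable {k : Type u} [Field k]

/-- The underlying space of a differential Perm-algebra with the product `a d(b)`. -/
def DiffPermAlg.Derived (P : DiffPermAlg.{u, v} k) : Type v := P.carrier

namespace DiffPermAlg.Derived

variable (P : DiffPermAlg.{u, v} k)

instance : AddCommGroup P.Derived := inferInstanceAs (AddCommGroup P.carrier)

instance : Module k P.Derived := inferInstanceAs (Module k P.carrier)

/-- The identity map to the differential Perm-algebra. -/
def toBase : P.Derived ≃ₗ[k] P.carrier := LinearEquiv.refl k P.carrier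

instance : Mul P.Derived := ⟨fun a b => (toBase P).symm (toBase P a * P.d (toBase P b))⟩

lemma toBase_mul (a b : P.Derived) : toBase P (a * b) = toBase P a * P.d (toBase P b) :=
  (toBase P).apply_symm_apply _

instance : NonUnitalNonAssocRing P.Derived where
  left_distrib a b c := (toBase P).injective <| by simp only [toBase_mul, map_add, mul_add]
  right_distrib a b c := (toBase P).injective <| by simp only [toBase_mul, map_add, add_mul]
  zero_mul a := (toBase P).injective <| by simp only [toBase_mul, map_zero, zero_mul]
  mul_zero a := (toBase P).injective <| by simp only [toBase_mul, map_zero, mul_zero]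

instance : IsScalarTower k P.Derived P.Derived := ⟨fun r a b => (toBase P).injective <| by
  simp only [smul_eq_mul, toBase_mul, map_smul, smul_mul_assoc]⟩

instance : SMulCommClass k P.Derived P.Derived := ⟨fun r a b => (toBase P).injective <| by
  simp only [smul_eq_mul, toBase_mul, map_smul, mul_smul_comm]⟩

end DiffPermAlg.Derived

/-- The first-order terms cancel by Leibniz. The remaining expression is symmetric in `a` and `b` by
the Perm identity, which is the source of both associator identities. -/
lemma associator_of_embedding {A : Type v} [NonUnitalNonAssocRing A] [Module k A]
    {P : DiffPermAlg.{u, v} k} {ι : A →ₗ[k] P.carrier}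
    (h : ∀ a b : A, ι (a * b) = ι a * P.d (ι b)) (a b c : A) :
    ι (associator a b c) = -(ι a * ι b * P.d (P.d (ι c))) := by
  rw [associator, map_sub, h, h, h, h, P.leibniz, mul_add, mul_assoc, mul_assoc]
  abel

lemma isSpecial_derived (P : DiffPermAlg.{u, v} k) : IsSpecial k P.Derived := by
  have h := associator_of_embedding (ι := (DiffPermAlg.Derived.toBase P).toLinearMap)
    (DiffPermAlg.Derived.toBase_mul P)
  refine ⟨fun a b c => (DiffPermAlg.Derived.toBase P).injective ?_, P,
    (DiffPermAlg.Derived.toBase P).toLinearMap, (DiffPermAlg.Derived.toBase P).injective,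
    DiffPermAlg.Derived.toBase_mul P⟩
  have h1 := h a b c
  rw [P.leftComm, ← h b a c] at h1
  exact h1

lemma IsSpecial.isSLS {A : Type v} [NonUnitalNonAssocRing A] [Module k A]
    (hA : IsSpecial k A) : IsSLS A := by
  obtain ⟨hl, P, ι, hι, h⟩ := hA
  refine ⟨hl, fun a x y b => hι ?_, fun x y a b => hι ?_⟩
  · simp only [h, mul_assoc]
    rw [← mul_assoc (P.d (ι x)), P.leftComm, mul_assoc]
  · rw [associator_of_embedding h, associator_of_embedding h, h, h, ← mul_assoc (ι x),
      ← mul_assoc (ι y), P.leftComm (ι x)]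

end Special

/-! ### The free differential Perm-algebra -/

noncomputable section FreeDiffPerm

open MvPolynomial

variable (k : Type u) [Field k] (X : Type v)

/-- The free module on the variables over the polynomial algebra in the variables `x⁽ⁿ⁾`: the
free differential Perm-algebra on `X`. -/
def FreeDiffPerm : Type (max u v) := (X × ℕ) →₀ MvPolynomial (X × ℕ) k

namespace FreeDiffPerm

instance : AddCommGroup (FreeDiffPerm k X) :=
  inferInstanceAs (AddCommGroup ((X × ℕ) →₀ MvPolynomial (X × ℕ) k))

instance : Module (MvPolynomial (X × ℕ) k) (FreeDiffPerm k X) :=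
  inferInstanceAs (Module (MvPolynomial (X × ℕ) k) ((X × ℕ) →₀ MvPolynomial (X × ℕ) k))

instance : Module k (FreeDiffPerm k X) :=
  inferInstanceAs (Module k ((X × ℕ) →₀ MvPolynomial (X × ℕ) k))

instance : IsScalarTower k (MvPolynomial (X × ℕ) k) (FreeDiffPerm k X) :=
  inferInstanceAs (IsScalarTower k _ ((X × ℕ) →₀ MvPolynomial (X × ℕ) k))

instance : SMulCommClass k (MvPolynomial (X × ℕ) k) (FreeDiffPerm k X) :=
  inferInstanceAs (SMulCommClass k _ ((X × ℕ) →₀ MvPolynomial (X × ℕ) k))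

/-- The projection onto the free differential commutative algebra. -/
def proj : FreeDiffPerm k X →ₗ[MvPolynomial (X × ℕ) k] MvPolynomial (X × ℕ) k :=
  Finsupp.linearCombination _ MvPolynomial.X

variable {k X}

/-- The element `r ⊗ s`. -/
def tmul (r : MvPolynomial (X × ℕ) k) (s : X × ℕ) : FreeDiffPerm k X := Finsupp.single s r

lemma add_tmul (r r' : MvPolynomial (X × ℕ) k) (s : X × ℕ) :
    tmul (r + r') s = tmul r s + tmul r' s := Finsupp.single_add _ _ _

lemma list_sum_tmul (L : List (MvPolynomial (X × ℕ) k)) (s : X × ℕ) :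
    tmul L.sum s = (L.map fun r => tmul r s).sum :=
  map_list_sum (Finsupp.singleAddHom s : MvPolynomial (X × ℕ) k →+ _) L

lemma smul_tmul (r r' : MvPolynomial (X × ℕ) k) (s : X × ℕ) :
    r • tmul r' s = tmul (r * r') s := Finsupp.smul_single _ _ _

lemma induction_linear {p : FreeDiffPerm k X → Prop} (u : FreeDiffPerm k X) (h0 : p 0)
    (hadd : ∀ u v, p u → p v → p (u + v)) (ht : ∀ r s, p (tmul r s)) : p u :=
  Finsupp.induction_linear u h0 hadd fun s r => ht r s

@[simp] lemma proj_tmul (r : MvPolynomial (X × ℕ) k) (s : X × ℕ) :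
    proj k X (tmul r s) = r * MvPolynomial.X s :=
  Finsupp.linearCombination_single _ _ _

instance : Mul (FreeDiffPerm k X) := ⟨fun u v => proj k X u • v⟩

lemma mul_def (u v : FreeDiffPerm k X) : u * v = proj k X u • v := rfl

@[simp] lemma proj_mul (u v : FreeDiffPerm k X) :
    proj k X (u * v) = proj k X u * proj k X v := map_smul (proj k X) _ v

instance : NonUnitalRing (FreeDiffPerm k X) where
  left_distrib u v w := smul_add _ v w
  right_distrib u v w := by simp only [mul_def, map_add, add_smul]
  zero_mul u := by simp only [mul_def, map_zero, zero_smul]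
  mul_zero u := smul_zero _
  mul_assoc u v w := by
    rw [mul_def (u * v), proj_mul, mul_smul]; rfl

instance : IsScalarTower k (FreeDiffPerm k X) (FreeDiffPerm k X) := ⟨fun c u v => by
  simp only [smul_eq_mul, mul_def, LinearMap.map_smul_of_tower, smul_assoc]⟩

instance : SMulCommClass k (FreeDiffPerm k X) (FreeDiffPerm k X) := ⟨fun c u v => by
  simp only [smul_eq_mul, mul_def, smul_comm c]⟩

variable (k X) in
/-- The derivation `x⁽ⁿ⁾ ↦ x⁽ⁿ⁺¹⁾` of the polynomial algebra. -/
def polyDerivation : Derivation k (MvPolynomial (X × ℕ) k) (MvPolynomial (X × ℕ) k) :=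
  mkDerivation k fun p => MvPolynomial.X (p.1, p.2 + 1)

@[simp] lemma polyDerivation_X (p : X × ℕ) :
    polyDerivation k X (MvPolynomial.X p) = MvPolynomial.X (p.1, p.2 + 1) :=
  mkDerivation_X _ _ _

variable (k X) in
/-- The derivation of the free differential Perm-algebra. -/
def derivation : FreeDiffPerm k X →ₗ[k] FreeDiffPerm k X :=
  Finsupp.lsum (R := k) k fun p => (Finsupp.lsingle p).comp (polyDerivation k X).toLinearMap +
    Finsupp.lsingle (p.1, p.2 + 1)

@[simp] lemma derivation_tmul (r : MvPolynomial (X × ℕ) k) (s : X × ℕ) :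
    derivation k X (tmul r s) = tmul (polyDerivation k X r) s + tmul r (s.1, s.2 + 1) :=
  (Finsupp.lsum_single _ _ _ _).trans rfl

lemma proj_derivation (u : FreeDiffPerm k X) :
    proj k X (derivation k X u) = polyDerivation k X (proj k X u) := by
  induction u using induction_linear with
  | h0 => simp
  | hadd u v hu hv => simp [hu, hv]
  | ht r s => simp [mul_comm, add_comm]

lemma derivation_smul (r : MvPolynomial (X × ℕ) k) (u : FreeDiffPerm k X) :
    derivation k X (r • u) = polyDerivation k X r • u + r • derivation k X u := by
  induction u using induction_linear with
  | h0 => simp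
  | hadd u v hu hv => simp only [smul_add, map_add, hu, hv]; abel
  | ht r' s =>
    simp only [smul_tmul, derivation_tmul, smul_add, Derivation.leibniz, smul_eq_mul, add_tmul,
      mul_comm r']
    abel

end FreeDiffPerm

/-- The free differential Perm-algebra. -/
def freeDiffPermAlg : DiffPermAlg.{u, max u v} k where
  carrier := FreeDiffPerm k X
  leftComm a b c := by
    rw [FreeDiffPerm.mul_def (a * b), FreeDiffPerm.mul_def (b * a), FreeDiffPerm.proj_mul,
      FreeDiffPerm.proj_mul, mul_comm]
  d := FreeDiffPerm.derivation k X
  leibniz a b := by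
    simp only [FreeDiffPerm.mul_def, FreeDiffPerm.derivation_smul, FreeDiffPerm.proj_derivation]

/-- The identity map to the free differential Perm-algebra with the product `a d(b)`. -/
def toDerived : FreeDiffPerm k X ≃ₗ[k] (freeDiffPermAlg k X).Derived :=
  LinearEquiv.refl k (FreeDiffPerm k X)

lemma toDerived_mul (u v : FreeDiffPerm k X) :
    toDerived k X u * toDerived k X v = toDerived k X (u * FreeDiffPerm.derivation k X v) := rfl

end FreeDiffPerm

/-! ### Evaluation of tree monomials in an SLS-algebra -/

noncomputable section Evaluation

variable {k : Type u} [Field k] {X : Type v} {A : Type*} [NonUnitalNonAssocRing A] [Module k A]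
  (α : X → A)

/-- The product of the variables in a multiset. -/
def multisetMonomial (k : Type u) [Field k] (M : Multiset (X × ℕ)) : MvPolynomial (X × ℕ) k :=
  (M.map MvPolynomial.X).prod

lemma multisetMonomial_eq (M : Multiset (X × ℕ)) [DecidableEq (X × ℕ)] :
    multisetMonomial k M = MvPolynomial.monomial (Multiset.toFinsupp M) 1 := by
  induction M using Multiset.induction with
  | empty => simp [multisetMonomial]
  | cons p M ih =>
    rw [multisetMonomial, Multiset.map_cons, Multiset.prod_cons, ← multisetMonomial, ih,
      ← Multiset.singleton_add, map_add, Multiset.toFinsupp_singleton, MvPolynomial.X,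
      MvPolynomial.monomial_mul, one_mul]

open Classical in
/-- The linear map from the free differential Perm-algebra that sends the monomial of a tree to
the value of the tree. -/
def treeValue : FreeDiffPerm k X →ₗ[k] A :=
  Finsupp.lsum (R := k) k fun p => (MvPolynomial.basisMonomials (X × ℕ) k).constr k fun N =>
    if h : ∃ l, Forest α (Finsupp.toMultiset N) l then brace h.choose (α p.1) else 0

lemma treeValue_tmul (hA : IsSLS A) {M : Multiset (X × ℕ)} {l : List A} (h : Forest α M l)
    (p : X × ℕ) :
    treeValue α (FreeDiffPerm.tmul (multisetMonomial k M) p) = brace l (α p.1) := by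
  classical
  have hex : ∃ l, Forest α M l := ⟨l, h⟩
  refine (Finsupp.lsum_single _ _ _ _).trans ?_
  have hb := congrFun (MvPolynomial.coe_basisMonomials (X × ℕ) k) (Multiset.toFinsupp M)
  rw [multisetMonomial_eq, ← hb, Module.Basis.constr_basis]
  simp only [Multiset.toFinsupp_toMultiset]
  rw [dif_pos hex]
  exact hex.choose_spec.apply_eq hA h (isCentral_brace hA.leftSymm _)

variable (k) in
/-- The pair of the monomial `M ⊗ c⁽ⁿ⁾` and the value `{x₁, …, xₙ; c}`. -/
def treePair (M : Multiset (X × ℕ)) (l : List A) (c : X) : (freeDiffPermAlg k X).Derived × A :=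
  (toDerived k X (FreeDiffPerm.tmul (multisetMonomial k M) (c, l.length)), brace l (α c))

variable (k) in
/-- The pairs of a monomial of a tree and the value of the tree. -/
def treePairs : Set ((freeDiffPermAlg k X).Derived × A) :=
  {q | ∃ M l c, Forest α M l ∧ q = treePair k α M l c}

lemma tmul_mul_tmul (r r' : MvPolynomial (X × ℕ) k) (s s' : X × ℕ) :
    FreeDiffPerm.tmul r s * FreeDiffPerm.derivation k X (FreeDiffPerm.tmul r' s') =
      FreeDiffPerm.tmul (r * MvPolynomial.X s * FreeDiffPerm.polyDerivation k X r') s' +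
        FreeDiffPerm.tmul (r * MvPolynomial.X s * r') (s'.1, s'.2 + 1) := by
  rw [FreeDiffPerm.mul_def, FreeDiffPerm.derivation_tmul, smul_add, FreeDiffPerm.smul_tmul,
    FreeDiffPerm.smul_tmul, FreeDiffPerm.proj_tmul]

/-- The first tree gets attached to every vertex of the second. Attaching at the root matches the
derivative of the module factor; attaching elsewhere matches the derivative of the polynomial
coefficient. -/
lemma mul_mem_span_treePairs (hA : IsSLS A) {p q : (freeDiffPermAlg k X).Derived × A}
    (hp : p ∈ treePairs k α) (hq : q ∈ treePairs k α) :
    p * q ∈ Submodule.span k (treePairs k α) := by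
  obtain ⟨M, l, b, h, rfl⟩ := hp
  obtain ⟨M', l', c, h', rfl⟩ := hq
  have hR : Forest α ((b, l.length) ::ₘ M) [brace l (α b)] := .node b rfl (by simpa using h)
  obtain ⟨L, hL, hX, hf⟩ := Forest.exists_derivative (FreeDiffPerm.polyDerivation_X (k := k)) hA hR h'
  have h1 : FreeDiffPerm.tmul (multisetMonomial k M) (b, l.length) *
      FreeDiffPerm.derivation k X (FreeDiffPerm.tmul (multisetMonomial k M') (c, l'.length)) =
      (L.map fun p => FreeDiffPerm.tmul (multisetMonomial k p.1) (c, l'.length)).sum +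
        FreeDiffPerm.tmul (multisetMonomial k ((b, l.length) ::ₘ M + M'))
          (c, (brace l (α b) :: l').length) := by
    have h2 : multisetMonomial k M * MvPolynomial.X (b, l.length) =
        multisetMonomial k ((b, l.length) ::ₘ M) := by
      rw [multisetMonomial, multisetMonomial, Multiset.map_cons, Multiset.prod_cons, mul_comm]
    have h3 : multisetMonomial k ((b, l.length) ::ₘ M + M') =
        multisetMonomial k ((b, l.length) ::ₘ M) * multisetMonomial k M' := by
      rw [multisetMonomial, Multiset.map_add, Multiset.prod_add]; rfl
    have h4 := FreeDiffPerm.list_sum_tmul (L.map fun p => multisetMonomial k p.1) (c, l'.length)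
    rw [List.map_map] at h4
    simp only [Function.comp_def] at h4
    rw [tmul_mul_tmul, h2, ← h4, h3]
    congr 2
    exact hX.symm
  have s1 := map_list_sum (AddMonoidHom.fst (freeDiffPermAlg k X).Derived A)
    (L.map fun p => treePair k α p.1 p.2 c)
  have s2 := map_list_sum (AddMonoidHom.snd (freeDiffPermAlg k X).Derived A)
    (L.map fun p => treePair k α p.1 p.2 c)
  rw [AddMonoidHom.coe_fst, List.map_map] at s1
  rw [AddMonoidHom.coe_snd, List.map_map] at s2
  have e : treePair k α M l b * treePair k α M' l' c =
      (L.map fun p => treePair k α p.1 p.2 c).sum +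
        treePair k α ((b, l.length) ::ₘ M + M') (brace l (α b) :: l') c := by
    refine Prod.ext ?_ ?_
    · rw [treePair, treePair, Prod.fst_mul, toDerived_mul, h1, map_add, map_list_sum,
        Prod.fst_add, s1, List.map_map]
      congr 2
      refine List.map_congr_left fun p hp => ?_
      simp only [Function.comp_apply, treePair, (hL p hp).2]
    · rw [treePair, treePair, Prod.snd_mul, mul_brace,
        hf _ (isCentral_brace hA.leftSymm (α c)), Prod.snd_add, s2, add_comm]
      rfl
  rw [e]
  refine add_mem (list_sum_mem ?_) (Submodule.subset_span ⟨_, _, _, hR.append h', rfl⟩)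
  intro x hx
  obtain ⟨p, hp, rfl⟩ := List.mem_map.1 hx
  exact Submodule.subset_span ⟨_, _, c, (hL p hp).1, rfl⟩

variable [IsScalarTower k A A] [SMulCommClass k A A]

variable (k) in
/-- The subalgebra of pairs of an element of the free special algebra and its value. -/
def treeSubalgebra (hA : IsSLS A) :
    NonUnitalSubalgebra k ((freeDiffPermAlg k X).Derived × A) where
  __ := Submodule.span k (treePairs k α)
  mul_mem' {p q} hp hq := by
    have h : Submodule.map₂ (LinearMap.mul k ((freeDiffPermAlg k X).Derived × A))
        (Submodule.span k (treePairs k α)) (Submodule.span k (treePairs k α)) ≤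
          Submodule.span k (treePairs k α) := by
      rw [Submodule.map₂_span_span, Submodule.span_le]
      rintro _ ⟨p, hp, q, hq, rfl⟩
      exact mul_mem_span_treePairs α hA hp hq
    exact h (Submodule.apply_mem_map₂ _ hp hq)

/-- The tree subalgebra lies in the graph of a linear map, so the second component is determined by
the first. -/
lemma treeValue_fst (hA : IsSLS A) {p : (freeDiffPermAlg k X).Derived × A}
    (hp : p ∈ treeSubalgebra k α hA) : treeValue α ((toDerived k X).symm p.1) = p.2 := by
  have h : Submodule.span k (treePairs k α) ≤
      LinearMap.eqLocus (((treeValue α).comp (toDerived k X).symm.toLinearMap).comp (LinearMap.fst k _ A)) (LinearMap.snd k _ A) := by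
    rw [Submodule.span_le]
    rintro _ ⟨M, l, c, h, rfl⟩
    exact treeValue_tmul α hA h _
  exact h hp

/-- Identities of the free special algebra hold in all SLS-algebras. -/
lemma IsSLS.lift_eq_zero (hA : IsSLS A) {Y : Type*} (e : Y → X)
    {f : FreeNonUnitalNonAssocAlgebra k Y}
    (hf : ∀ a : Y → (freeDiffPermAlg k X).Derived, FreeNonUnitalNonAssocAlgebra.lift k a f = 0) :
    FreeNonUnitalNonAssocAlgebra.lift k (α ∘ e) f = 0 := by
  let gen : Y → (freeDiffPermAlg k X).Derived :=
    fun y => toDerived k X (FreeDiffPerm.tmul (multisetMonomial k 0) (e y, 0))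
  have hgen : ∀ y, (gen y, α (e y)) ∈ treeSubalgebra k α hA := fun y =>
    Submodule.subset_span ⟨0, [], e y, .nil, rfl⟩
  let Φ := FreeNonUnitalNonAssocAlgebra.lift k
    (fun y => (⟨(gen y, α (e y)), hgen y⟩ : treeSubalgebra k α hA))
  have h1 : (NonUnitalAlgHom.fst k (freeDiffPermAlg k X).Derived A).comp
      ((NonUnitalSubalgebraClass.subtype (treeSubalgebra k α hA)).comp Φ) =
        FreeNonUnitalNonAssocAlgebra.lift k gen := by
    refine FreeNonUnitalNonAssocAlgebra.hom_ext k ?_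
    intro y
    simp [Φ]
  have h2 : (NonUnitalAlgHom.snd k (freeDiffPermAlg k X).Derived A).comp
      ((NonUnitalSubalgebraClass.subtype (treeSubalgebra k α hA)).comp Φ) =
        FreeNonUnitalNonAssocAlgebra.lift k (α ∘ e) := by
    refine FreeNonUnitalNonAssocAlgebra.hom_ext k ?_
    intro y
    simp [Φ]
  have h3 := treeValue_fst α hA (Φ f).2
  rw [← h2]
  refine h3.symm.trans ?_
  have h4 : (Φ f : (freeDiffPermAlg k X).Derived × A).1 = 0 :=
    (DFunLike.congr_fun h1 f).trans (hf gen)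
  rw [h4, map_zero, map_zero]

end Evaluation

/-! ### SLS-algebras as the least variety -/

noncomputable section Variety

variable (k : Type u) [Field k]

open FreeNonUnitalNonAssocAlgebra

/-- The defining identities of SLS-algebras. -/
def slsIdentities : Set (FreeNonUnitalNonAssocAlgebra k ℕ) :=
  {associator (of k 0) (of k 1) (of k 2) - associator (of k 1) (of k 0) (of k 2),
    ((of k 0 * of k 1) * of k 2) * of k 3 - ((of k 0 * of k 2) * of k 1) * of k 3,
    associator (of k 0) (of k 1 * of k 2) (of k 3) -
      associator (of k 1) (of k 0 * of k 2) (of k 3)}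

lemma isVariety_isSLS : IsVariety {A : NAAlg.{u, v} k | IsSLS A.carrier} := by
  refine ⟨slsIdentities k, Set.ext fun A => ?_⟩
  simp only [slsIdentities, Set.mem_ofPred_eq, Set.mem_insert_iff, Set.mem_singleton_iff,
    forall_eq_or_imp, forall_eq, NAAlg.Satisfies, associator, map_sub, map_mul, lift_of_apply,
    sub_eq_zero (G := A.carrier)]
  constructor
  · rintro ⟨h1, h2, h3⟩
    exact ⟨fun a => h1 (a 0) (a 1) (a 2), fun a => h2 (a 0) (a 1) (a 2) (a 3),
      fun a => h3 (a 0) (a 1) (a 2) (a 3)⟩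
  · rintro ⟨h1, h2, h3⟩
    refine ⟨fun a b c => ?_, fun a x y b => ?_, fun x y a b => ?_⟩
    · simpa [associator] using h1 fun n => [a, b, c].getD n 0
    · simpa [associator] using h2 fun n => [a, x, y, b].getD n 0
    · simpa [associator] using h3 fun n => [x, y, a, b].getD n 0

end Variety

theorem mainTheorem4 (k : Type u) [Field k] :
    IsLeast
      {V : Set (NAAlg.{u, max u v} k) |
        IsVariety V ∧ ∀ A : NAAlg.{u, max u v} k, IsSpecial k A.carrier → A ∈ V}
      {A : NAAlg.{u, max u v} k | IsSLS A.carrier} := by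
  refine ⟨⟨isVariety_isSLS k, fun A hA => hA.isSLS⟩, ?_⟩
  rintro _ ⟨⟨S, rfl⟩, hV⟩ A hA f hf a
  -- Lifting the variables to universe `v` places the free algebra in `max u v`, where the variety
  -- lives.
  exact IsSLS.lift_eq_zero (X := ULift.{v} ℕ) (a ∘ ULift.down) hA ULift.up fun b =>
    hV ⟨(freeDiffPermAlg k (ULift.{v} ℕ)).Derived⟩ (isSpecial_derived _) f hf b
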